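/- A frame $L$ is \emph{zero-dimensional} if every element of $L$ is a join of complemented elements. A \emph{Frith frame} is a pair $(L,S)$ with $L$ a frame and $S$ a bounded sublattice of $L$ such that every element of $L$ is a join of elements of $S$; a morphism $(L,S)\to(M,T)$ is a frame homomorphism $h:L\to M$ with $h[S]\subseteq T$. For $a\in L$ let $\nabla_a=\{(x,y)\mid a\vee x=a\vee y\}$ and $\Delta_a=\{(x,y)\mid a\wedge x=a\wedge y\}$ be the closed and open congruences in the frame $\mathcal C L$ of all frame congruences on $L$, ordered by inclusion; congruences of the form $\Delta_a$ are called open. Let $\nabla L$, $\Delta S$ and $\mathcal C_S L$ be the subframes of $\mathcal C L$ generated by $\{\nabla_a\mid a\in L\}$, by $\{\Delta_s\mid s\in S\}$, and by $\nabla L\cup\Delta S$, respectively. The Frith frame $(L,S)$ is \emph{symmetric} if $S$ is a Boolean algebra, and \emph{strongly exact} if $\bigwedge P\in S$ for every $P\subseteq S$ such that the congruence $\bigvee_{s\in P}\Delta_s$ is open. For a frame $L$ let $\mathbb B(L)$ be the lattice of its complemented elements and $\langle\mathbb B(L)\rangle$ the subframe of $L$ generated by it. \textbf{Proposition.} The category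 of zero-dimensional frames and frame homomorphisms is equivalent to the category of strongly exact symmetric Frith frames and their morphisms. The equivalence is given, up to natural isomorphism, by the restrictions of the functors $\mathbf B: L\mapsto(\langle\mathbb B(L)\rangle,\mathbb B(L))$ (from frames to Frith frames) and $\mathbf U:(L,S)\mapsto L$ (from Frith frames to frames). Moreover, let $\mathbf{FrithFrm}'$ be the full subcategory of those Frith frames $(L,S)$ for which the biframe $(\mathcal C_S L,\nabla L,\Delta S)$ is a frame, i.e. $\nabla L=\mathcal C_S L=\Delta S$. Then $a\mapsto\nabla_a$ is an isomorphism $L\cong\mathcal C_S L$ for each $(L,S)$ in $\mathbf{FrithFrm}'$; the restriction $\mathbf U':\mathbf{FrithFrm}'\to\mathbf{Frm}$ of $\mathbf U$ is left adjoint to $\mathbf B:\mathbf{Frm}\to\mathbf{FrithFrm}'$; and there are a unit and a counit for this adjunction such that the counit at a frame $L$ is an isomorphism if and only if $L$ is zero-dimensional, and the unit at an object $(L,S)$ of $\mathbf{FrithFrm}'$ is an isomorphism if and only if $(L,S)$ is strongly exact and symmetric. -/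

import Mathlib

open CategoryTheory

universe u

section Subframes

/-- A subframe of a complete lattice: a subset closed under finite meets (including the empty
meet `⊤`) and arbitrary joins. -/
structure Subframe (L : Type u) [CompleteLattice L] where
  carrier : Set L
  top_mem : ⊤ ∈ carrier
  inf_mem : ∀ {a b : L}, a ∈ carrier → b ∈ carrier → a ⊓ b ∈ carrier
  sSup_mem : ∀ {A : Set L}, A ⊆ carrier → sSup A ∈ carrier

/-- The subframe generated by a subset. -/
def Subframe.closure {L : Type u} [CompleteLattice L] (A : Set L) : Subframe L where
  carrier := {a | ∀ K : Subframe L, A ⊆ K.carrier → a ∈ K.carrier}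
  top_mem := fun K _ => K.top_mem
  inf_mem := fun ha hb K hK => K.inf_mem (ha K hK) (hb K hK)
  sSup_mem := fun hB K hK => K.sSup_mem fun _ hb => hB hb K hK

theorem Subframe.subset_closure {L : Type u} [CompleteLattice L] (A : Set L) :
    A ⊆ (Subframe.closure A).carrier :=
  fun _ ha _ hK => hK ha

/-- The underlying type of a subframe. -/
@[ext]
structure Subframe.Elem {L : Type u} [CompleteLattice L] (K : Subframe L) : Type u where
  val : L
  mem : val ∈ K.carrier

instance Subframe.Elem.instPartialOrder {L : Type u} [CompleteLattice L] (K : Subframe L) :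
    PartialOrder K.Elem :=
  PartialOrder.lift Subframe.Elem.val fun _ _ h => Subframe.Elem.ext h

instance Subframe.Elem.instSupSet {L : Type u} [CompleteLattice L] (K : Subframe L) :
    SupSet K.Elem where
  sSup A := ⟨sSup (Subframe.Elem.val '' A), K.sSup_mem (by rintro _ ⟨x, -, rfl⟩; exact x.2)⟩

/-- Finite meets and arbitrary joins in a subframe are those of the ambient lattice. -/
instance Subframe.Elem.instCompleteLattice {L : Type u} [CompleteLattice L] (K : Subframe L) :
    CompleteLattice K.Elem where
  top := ⟨⊤, K.top_mem⟩
  le_top x := show x.1 ≤ ⊤ from le_top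
  inf x y := ⟨x.1 ⊓ y.1, K.inf_mem x.2 y.2⟩
  inf_le_left x y := show x.1 ⊓ y.1 ≤ x.1 from inf_le_left
  inf_le_right x y := show x.1 ⊓ y.1 ≤ y.1 from inf_le_right
  le_inf x y z hxy hxz := show x.1 ≤ y.1 ⊓ z.1 from le_inf hxy hxz
  __ := completeLatticeOfSup K.Elem fun A =>
    ⟨fun x hx => show x.1 ≤ sSup (Subframe.Elem.val '' A) from le_sSup ⟨x, hx, rfl⟩,
      fun y hy => show sSup (Subframe.Elem.val '' A) ≤ y.1 from
        sSup_le (by rintro _ ⟨x, hx, rfl⟩; exact hy hx)⟩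

instance Subframe.Elem.instFrame {L : Type u} [Order.Frame L] (K : Subframe L) :
    Order.Frame K.Elem :=
  Order.Frame.ofMinimalAxioms
    { inf_sSup_le_iSup_inf := fun a A => by
        change a.1 ⊓ sSup (Subframe.Elem.val '' A) ≤ (⨆ b ∈ A, a ⊓ b : K.Elem).1
        rw [inf_sSup_eq]
        refine iSup₂_le ?_
        rintro _ ⟨b, hb, rfl⟩
        exact (show a ⊓ b ≤ (⨆ b ∈ A, a ⊓ b : K.Elem) from le_iSup₂_of_le b hb le_rfl) }

end Subframes

section Congruences

/-- A frame congruence: an equivalence relation compatible with finite meets and arbitrary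
joins. -/
structure FrameCongruence (L : Type u) [Order.Frame L] extends Setoid L where
  inf_compat : ∀ {a b c d : L}, r a b → r c d → r (a ⊓ c) (b ⊓ d)
  iSup_compat : ∀ {ι : Type u} {f g : ι → L}, (∀ i, r (f i) (g i)) → r (⨆ i, f i) (⨆ i, g i)

variable {L : Type u} [Order.Frame L]

theorem FrameCongruence.ext_rel {θ φ : FrameCongruence L}
    (h : ∀ x y, θ.r x y ↔ φ.r x y) : θ = φ := by
  obtain ⟨⟨r, hr⟩, h1, h2⟩ := θ
  obtain ⟨⟨r', hr'⟩, h1', h2'⟩ := φ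
  obtain rfl : r = r' := by
    funext x y
    exact propext (h x y)
  rfl

/-- Congruences are ordered by inclusion. -/
instance FrameCongruence.instPartialOrder : PartialOrder (FrameCongruence L) where
  le θ φ := ∀ x y, θ.r x y → φ.r x y
  le_refl _ _ _ h := h
  le_trans _ _ _ h₁ h₂ x y h := h₂ x y (h₁ x y h)
  le_antisymm _ _ h₁ h₂ := FrameCongruence.ext_rel fun x y => ⟨h₁ x y, h₂ x y⟩

instance FrameCongruence.instInfSet : InfSet (FrameCongruence L) where
  sInf C :=
    { r := fun x y => ∀ θ ∈ C, θ.r x y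
      iseqv := ⟨fun x θ _ => θ.iseqv.refl x, fun h θ hθ => θ.iseqv.symm (h θ hθ),
        fun h₁ h₂ θ hθ => θ.iseqv.trans (h₁ θ hθ) (h₂ θ hθ)⟩
      inf_compat := fun h₁ h₂ θ hθ => θ.inf_compat (h₁ θ hθ) (h₂ θ hθ)
      iSup_compat := fun h θ hθ => θ.iSup_compat fun i => h i θ hθ }

/-- The complete lattice of all frame congruences on `L`; meets are intersections. -/
instance FrameCongruence.instCompleteLattice : CompleteLattice (FrameCongruence L) :=
  completeLatticeOfInf _ fun C =>
    ⟨fun θ hθ _ _ h => h θ hθ, fun _ hφ x y h θ hθ => hφ hθ x y h⟩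

/-- The closed congruence `∇ a = {(x, y) | a ⊔ x = a ⊔ y}`. -/
def closedCongr (a : L) : FrameCongruence L where
  r x y := a ⊔ x = a ⊔ y
  iseqv := ⟨fun _ => rfl, fun h => h.symm, fun h₁ h₂ => h₁.trans h₂⟩
  inf_compat := by
    intro p q s t h₁ h₂
    rw [sup_inf_left, sup_inf_left, h₁, h₂]
  iSup_compat := by
    intro ι f g h
    apply le_antisymm
    · exact sup_le le_sup_left (iSup_le fun i => (le_sup_right.trans (h i).le).trans
        (sup_le_sup_left (le_iSup g i) a))
    · exact sup_le le_sup_left (iSup_le fun i => (le_sup_right.trans (h i).ge).trans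
        (sup_le_sup_left (le_iSup f i) a))

/-- The open congruence `Δ a = {(x, y) | a ⊓ x = a ⊓ y}`. -/
def openCongr (a : L) : FrameCongruence L where
  r x y := a ⊓ x = a ⊓ y
  iseqv := ⟨fun _ => rfl, fun h => h.symm, fun h₁ h₂ => h₁.trans h₂⟩
  inf_compat := by
    intro p q s t h₁ h₂
    rw [inf_inf_distrib_left, h₁, h₂, ← inf_inf_distrib_left]
  iSup_compat := by
    intro ι f g h
    rw [inf_iSup_eq, inf_iSup_eq]
    exact iSup_congr h

/-- `∇L`, the subframe of the congruence frame generated by the closed congruences. -/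
def nablaFrame (L : Type u) [Order.Frame L] : Subframe (FrameCongruence L) :=
  Subframe.closure (Set.range closedCongr)

/-- `ΔS`, the subframe of the congruence frame generated by the open congruences `Δ s`,
`s ∈ S`. -/
def deltaFrame (S : Set L) : Subframe (FrameCongruence L) :=
  Subframe.closure (openCongr '' S)

/-- `C_S L`, the subframe of the congruence frame generated by `∇L ∪ ΔS`. -/
def congrFrame (S : Set L) : Subframe (FrameCongruence L) :=
  Subframe.closure ((nablaFrame L).carrier ∪ (deltaFrame S).carrier)

/-- The meet of `P` is strongly exact: the congruence `⨆ s ∈ P, Δ s` is open. -/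
def IsStronglyExactMeet (P : Set L) : Prop :=
  ∃ a : L, (⨆ s ∈ P, openCongr s) = openCongr a

end Congruences

section FrithFrames

/-- A Frith frame: a frame `L` with a join-dense bounded sublattice `S` of `L`. -/
structure FrithFrame where
  frame : Frm.{u}
  base : Set frame
  bot_mem : ⊥ ∈ base
  top_mem : ⊤ ∈ base
  sup_mem : ∀ {a b : frame}, a ∈ base → b ∈ base → a ⊔ b ∈ base
  inf_mem : ∀ {a b : frame}, a ∈ base → b ∈ base → a ⊓ b ∈ base
  join_dense : ∀ a : frame, ∃ P ⊆ base, a = sSup P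

/-- A morphism of Frith frames: a frame homomorphism mapping the sublattice into the
sublattice. -/
@[ext]
structure FrithFrame.Hom (X Y : FrithFrame.{u}) where
  hom : X.frame ⟶ Y.frame
  map_mem : ∀ s ∈ X.base, hom s ∈ Y.base

instance FrithFrame.instCategory : Category FrithFrame.{u} where
  Hom := FrithFrame.Hom
  id X := ⟨𝟙 X.frame, fun _ hs => hs⟩
  comp f g := ⟨f.hom ≫ g.hom, fun s hs => g.map_mem _ (f.map_mem s hs)⟩

/-- `S` is a Boolean algebra. -/
def FrithFrame.IsSymmetric (X : FrithFrame.{u}) : Prop :=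
  ∀ s ∈ X.base, ∃ t ∈ X.base, IsCompl s t

/-- `S` is closed under strongly exact meets. -/
def FrithFrame.IsStronglyExact (X : FrithFrame.{u}) : Prop :=
  ∀ P : Set X.frame, P ⊆ X.base → IsStronglyExactMeet P → sInf P ∈ X.base

/-- The biframe `(C_S L, ∇L, ΔS)` is a frame, i.e. its three components coincide. -/
def FrithFrame.IsMono : ObjectProperty FrithFrame.{u} := fun X =>
  nablaFrame X.frame = congrFrame X.base ∧ deltaFrame X.base = congrFrame X.base

/-- The forgetful functor `(L, S) ↦ L`. -/
def frithForget : FrithFrame.{u} ⥤ Frm.{u} where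
  obj X := X.frame
  map f := f.hom

/-- A frame is zero-dimensional if every element is a join of complemented elements. -/
def IsZeroDimensionalFrame : ObjectProperty Frm.{u} := fun L =>
  ∀ a : L, ∃ P : Set L, P ⊆ {b | IsComplemented b} ∧ a = sSup P

end FrithFrames

section ComplementedElements

/-- The subframe of `L` generated by its complemented elements. -/
def complSubframe (L : Type u) [Order.Frame L] : Subframe L :=
  Subframe.closure {b : L | IsComplemented b}

theorem exists_sSup_of_mem_complSubframe {L : Type u} [Order.Frame L] {a : L}
    (ha : a ∈ (complSubframe L).carrier) : ∃ P : Set L, P ⊆ {b | IsComplemented b} ∧ a = sSup P :=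
  ha
    { carrier := {a | ∃ P : Set L, P ⊆ {b | IsComplemented b} ∧ a = sSup P}
      top_mem := ⟨{⊤}, by simpa using isComplemented_top, by simp⟩
      inf_mem := by
        rintro _ _ ⟨P, hP, rfl⟩ ⟨Q, hQ, rfl⟩
        refine ⟨(fun p : L × L => p.1 ⊓ p.2) '' P ×ˢ Q, ?_, ?_⟩
        · rintro _ ⟨⟨p, q⟩, ⟨hp, hq⟩, rfl⟩
          exact (hP hp).inf (hQ hq)
        · rw [sSup_inf_sSup, sSup_image]
      sSup_mem := by
        intro A hA
        refine ⟨{b | IsComplemented b ∧ b ≤ sSup A}, fun b hb => hb.1, le_antisymm ?_ ?_⟩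
        · refine sSup_le fun a haA => ?_
          obtain ⟨P, hP, rfl⟩ := hA haA
          exact sSup_le fun p hp => le_sSup ⟨hP hp, (le_sSup hp).trans (le_sSup haA)⟩
        · exact sSup_le fun b hb => hb.2 }
    fun b hb => ⟨{b}, by simpa using hb, by simp⟩

/-- The Frith frame `(⟨B(L)⟩, B(L))`, where `B(L)` is the lattice of complemented elements of `L`
and `⟨B(L)⟩` is the subframe of `L` that it generates. -/
def complFrith (L : Frm.{u}) : FrithFrame.{u} where
  frame := Frm.of (complSubframe L).Elem
  base := {x : (complSubframe L).Elem | IsComplemented x.1}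
  bot_mem := by
    change IsComplemented (sSup (Subframe.Elem.val '' (∅ : Set (complSubframe L).Elem)))
    simpa using isComplemented_bot
  top_mem := isComplemented_top (α := L)
  sup_mem := by
    intro a b ha hb
    change IsComplemented (sSup (Subframe.Elem.val '' ({a, b} : Set (complSubframe L).Elem)))
    rw [Set.image_pair, sSup_pair]
    exact IsComplemented.sup (α := L) ha hb
  inf_mem := fun ha hb => IsComplemented.inf (α := L) ha hb
  join_dense := by
    intro a
    obtain ⟨P, hP, h⟩ := exists_sSup_of_mem_complSubframe a.2
    refine ⟨{x : (complSubframe L).Elem | x.1 ∈ P}, fun x hx => hP hx, Subframe.Elem.ext ?_⟩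
    change a.1 = sSup (Subframe.Elem.val '' {x : (complSubframe L).Elem | x.1 ∈ P})
    rw [h]
    congr 1
    ext p
    exact ⟨fun hp => ⟨⟨p, Subframe.subset_closure _ (hP hp)⟩, hp, rfl⟩,
      by rintro ⟨x, hx, rfl⟩; exact hx⟩

theorem map_isComplemented {L M : Type u} [Order.Frame L] [Order.Frame M] (h : FrameHom L M)
    {a : L} (ha : IsComplemented a) : IsComplemented (h a) := by
  obtain ⟨b, hb⟩ := ha
  exact ⟨h b, hb.map h⟩

theorem map_mem_complSubframe {L M : Type u} [Order.Frame L] [Order.Frame M] (h : FrameHom L M)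
    {a : L} (ha : a ∈ (complSubframe L).carrier) : h a ∈ (complSubframe M).carrier := by
  obtain ⟨P, hP, rfl⟩ := exists_sSup_of_mem_complSubframe ha
  rw [map_sSup]
  apply (complSubframe M).sSup_mem
  rintro _ ⟨p, hp, rfl⟩
  exact Subframe.subset_closure _ (map_isComplemented h (hP hp))

/-- The restriction and corestriction of a frame homomorphism to the subframes generated by the
complemented elements. -/
def complFrameHom {L M : Type u} [Order.Frame L] [Order.Frame M] (h : FrameHom L M) :
    FrameHom (complSubframe L).Elem (complSubframe M).Elem where
  toFun x := ⟨h x.1, map_mem_complSubframe h x.2⟩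
  map_inf' x y := Subframe.Elem.ext (map_inf h x.1 y.1)
  map_top' := Subframe.Elem.ext (map_top h)
  map_sSup' A := Subframe.Elem.ext <| by
    change h (sSup (Subframe.Elem.val '' A)) = sSup (Subframe.Elem.val '' _)
    rw [map_sSup, Set.image_image, Set.image_image]

/-- The functor `B : L ↦ (⟨B(L)⟩, B(L))` from frames to Frith frames. -/
def complFunctor : Frm.{u} ⥤ FrithFrame.{u} where
  obj := complFrith
  map h := ⟨Frm.ofHom (complFrameHom h.hom), fun _ hs => map_isComplemented h.hom hs⟩

theorem openCongr_eq_closedCongr {L : Type u} [Order.Frame L] {s t : L} (h : IsCompl s t) :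
    openCongr s = closedCongr t := by
  apply FrameCongruence.ext_rel
  intro x y
  change s ⊓ x = s ⊓ y ↔ t ⊔ x = t ⊔ y
  constructor
  · intro e
    have key : ∀ z : L, t ⊔ s ⊓ z = t ⊔ z := fun z => by
      rw [sup_inf_left, sup_comm t s, h.sup_eq_top, top_inf_eq]
    rw [← key x, ← key y, e]
  · intro e
    have key : ∀ z : L, s ⊓ (t ⊔ z) = s ⊓ z := fun z => by
      rw [inf_sup_left, h.inf_eq_bot, bot_sup_eq]
    rw [← key x, ← key y, e]

theorem closedCongr_sSup {L : Type u} [Order.Frame L] (P : Set L) :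
    closedCongr (sSup P) = sSup (closedCongr '' P) := by
  apply le_antisymm
  · intro x y e
    set φ : FrameCongruence L := sSup (closedCongr '' P) with hφ
    have h0 : φ.r ⊥ (sSup P) := by
      have h1 : ∀ p : P, φ.r ⊥ p.1 := fun p => by
        have hle : closedCongr p.1 ≤ φ := le_sSup ⟨p.1, p.2, rfl⟩
        exact hle _ _ (show p.1 ⊔ ⊥ = p.1 ⊔ p.1 by simp)
      have h2 := φ.iSup_compat h1
      rwa [iSup_bot, ← sSup_eq_iSup'] at h2
    have join : ∀ {a b c d : L}, φ.r a b → φ.r c d → φ.r (a ⊔ c) (b ⊔ d) := by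
      intro a b c d hab hcd
      have h3 := φ.iSup_compat (ι := ULift.{u} Bool) (f := fun i => cond i.down a c)
        (g := fun i => cond i.down b d) (by rintro ⟨_ | _⟩ <;> assumption)
      have conv : ∀ p q : L, (⨆ i : ULift.{u} Bool, cond i.down p q) = p ⊔ q := fun p q => by
        rw [iSup_ulift, iSup_bool_eq]; rfl
      rwa [conv, conv] at h3
    have h4 : ∀ z : L, φ.r z (sSup P ⊔ z) := fun z => by
      simpa using join h0 (φ.iseqv.refl z)
    have e' : sSup P ⊔ x = sSup P ⊔ y := e
    have h5 := h4 x
    rw [e'] at h5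
    exact φ.iseqv.trans h5 (φ.iseqv.symm (h4 y))
  · refine sSup_le ?_
    rintro _ ⟨p, hp, rfl⟩ x y e
    change sSup P ⊔ x = sSup P ⊔ y
    have e' : p ⊔ x = p ⊔ y := e
    rw [← sup_eq_left.2 (le_sSup hp), sup_assoc, sup_assoc, e']

theorem Subframe.eq_of_carrier {L : Type u} [CompleteLattice L] {K M : Subframe L}
    (h : K.carrier = M.carrier) : K = M := by
  cases K; cases M; cases h; rfl

/-- A symmetric Frith frame `(L, S)` satisfies `∇L = C_S L = ΔS`. -/
theorem FrithFrame.IsSymmetric.isMono {X : FrithFrame.{u}} (hX : X.IsSymmetric) :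
    FrithFrame.IsMono X := by
  have h1 : (nablaFrame X.frame).carrier ⊆ (deltaFrame X.base).carrier := by
    intro θ hθ
    refine hθ _ ?_
    rintro _ ⟨a, rfl⟩
    obtain ⟨P, hP, rfl⟩ := X.join_dense a
    rw [closedCongr_sSup]
    apply Subframe.sSup_mem
    rintro _ ⟨p, hp, rfl⟩
    obtain ⟨q, hq, hpq⟩ := hX p (hP hp)
    rw [← openCongr_eq_closedCongr hpq.symm]
    exact Subframe.subset_closure _ ⟨q, hq, rfl⟩
  have h2 : (deltaFrame X.base).carrier ⊆ (nablaFrame X.frame).carrier := by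
    intro θ hθ
    refine hθ _ ?_
    rintro _ ⟨s, hs, rfl⟩
    obtain ⟨t, -, hst⟩ := hX s hs
    rw [openCongr_eq_closedCongr hst]
    exact Subframe.subset_closure _ ⟨t, rfl⟩
  have h3 : (nablaFrame X.frame).carrier = (congrFrame X.base).carrier :=
    Set.Subset.antisymm (fun θ hθ => Subframe.subset_closure _ (Or.inl hθ))
      (fun θ hθ => hθ _ (Set.union_subset (fun _ h => h) h2))
  exact ⟨Subframe.eq_of_carrier h3,
    Subframe.eq_of_carrier ((Set.Subset.antisymm h2 h1).trans h3)⟩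

theorem complFrith_isSymmetric (L : Frm.{u}) : (complFrith L).IsSymmetric := by
  rintro ⟨s, hs⟩ ⟨t, hst⟩
  have hst : IsCompl s t := hst
  have ht : IsComplemented t := ⟨s, hst.symm⟩
  refine ⟨⟨t, Subframe.subset_closure _ ht⟩, ht, ?_⟩
  refine ⟨fun x hx hx' => ?_, fun x hx hx' => ?_⟩
  · exact (show x.1 ≤ ⊥ from hst.disjoint hx hx').trans bot_le
  · exact (show (⊤ : L) ≤ x.1 from hst.codisjoint hx hx')

end ComplementedElements

section Categories

/-- The full subcategory of Frith frames `(L, S)` for which `(C_S L, ∇L, ΔS)` is a frame. -/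
abbrev MonoFrith := FrithFrame.IsMono.{u}.FullSubcategory

/-- `(L, S) ↦ L`, restricted to `MonoFrith`. -/
def monoForget : MonoFrith.{u} ⥤ Frm.{u} :=
  FrithFrame.IsMono.ι ⋙ frithForget

/-- `L ↦ (⟨B(L)⟩, B(L))`, corestricted to `MonoFrith`. -/
def complToMono : Frm.{u} ⥤ MonoFrith.{u} :=
  FrithFrame.IsMono.lift complFunctor fun L => (complFrith_isSymmetric L).isMono

/-- The property of being a strongly exact symmetric Frith frame. -/
def FrithFrame.IsStronglyExactSymmetric : ObjectProperty FrithFrame.{u} := fun X =>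
  X.IsStronglyExact ∧ X.IsSymmetric

/-- The category of zero-dimensional frames and frame homomorphisms. -/
abbrev ZeroDimFrm := IsZeroDimensionalFrame.{u}.FullSubcategory

/-- The category of strongly exact symmetric Frith frames and their morphisms. -/
abbrev SESymFrith := FrithFrame.IsStronglyExactSymmetric.{u}.FullSubcategory

end Categories

/-! ### Closed and open congruences. -/

section ClosedCongruences

variable {L : Type u} [Order.Frame L]

/-! Everything reduces to complemented elements. The closed congruences already form a subframe
isomorphic to `L` (`mem_nablaFrame`). So if `∇L = C_S L = ΔS`, each `Δ s` with `s ∈ S` equals some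
`∇ t`, and then `t` is a complement of `s` (`isCompl_of_openCongr_eq_closedCongr`). Hence `S ⊆
B(L)`, and join-density gives `⟨B(L)⟩ = L`.

The unit is therefore the identity of `L` regarded as a morphism from `(L, S)` to `(⟨B(L)⟩, B(L))`;
it is invertible exactly when `S = B(L)`. By `FrithFrame.isStronglyExactSymmetric_iff` this is the
same as `(L, S)` being strongly exact and symmetric. The counit is the inclusion of `⟨B(L)⟩` in `L`,
invertible exactly when `L` is zero-dimensional. The equivalence is this adjunction restricted to
the objects where unit and counit are invertible. -/

theorem closedCongr_le_closedCongr {a b : L} : closedCongr a ≤ closedCongr b ↔ a ≤ b := by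
  constructor
  · intro h
    have h1 : b ⊔ ⊥ = b ⊔ a := h ⊥ a (show a ⊔ ⊥ = a ⊔ a by simp)
    rw [sup_bot_eq] at h1
    exact h1 ▸ le_sup_right
  · intro h x y e
    have e' : a ⊔ x = a ⊔ y := e
    change b ⊔ x = b ⊔ y
    rw [← sup_eq_left.2 h, sup_assoc, sup_assoc, e']

theorem openCongr_le_openCongr {a b : L} : openCongr a ≤ openCongr b ↔ b ≤ a := by
  constructor
  · intro h
    have h1 : b ⊓ ⊤ = b ⊓ a := h ⊤ a (show a ⊓ ⊤ = a ⊓ a by simp)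
    rw [inf_top_eq] at h1
    exact h1 ▸ inf_le_right
  · intro h x y e
    have e' : a ⊓ x = a ⊓ y := e
    change b ⊓ x = b ⊓ y
    rw [← inf_eq_left.2 h, inf_assoc, inf_assoc, e']

theorem closedCongr_inf (a b : L) : closedCongr (a ⊓ b) = closedCongr a ⊓ closedCongr b := by
  refine le_antisymm (le_inf (closedCongr_le_closedCongr.2 inf_le_left)
    (closedCongr_le_closedCongr.2 inf_le_right)) fun x y e => ?_
  have ha : a ⊔ x = a ⊔ y := (inf_le_left : closedCongr a ⊓ closedCongr b ≤ _) x y e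
  have hb : b ⊔ x = b ⊔ y := (inf_le_right : closedCongr a ⊓ closedCongr b ≤ _) x y e
  change a ⊓ b ⊔ x = a ⊓ b ⊔ y
  rw [sup_inf_right, sup_inf_right, ha, hb]

theorem closedCongr_top : closedCongr (⊤ : L) = ⊤ :=
  top_le_iff.1 fun x y _ => show ⊤ ⊔ x = ⊤ ⊔ y by simp

/-- The closed congruences already form a subframe. -/
theorem mem_nablaFrame {θ : FrameCongruence L} :
    θ ∈ (nablaFrame L).carrier ↔ ∃ a, closedCongr a = θ := by
  refine ⟨fun hθ => hθ
    { carrier := Set.range closedCongr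
      top_mem := ⟨⊤, closedCongr_top⟩
      inf_mem := ?_
      sSup_mem := ?_ } subset_rfl, ?_⟩
  · rintro _ _ ⟨a, rfl⟩ ⟨b, rfl⟩
    exact ⟨a ⊓ b, closedCongr_inf a b⟩
  · intro A hA
    -- Since `∇` preserves joins, the join of a family of closed congruences is `∇` of the join of
    -- their parameters.
    refine ⟨sSup (closedCongr ⁻¹' A), ?_⟩
    rw [closedCongr_sSup, Set.image_preimage_eq_of_subset hA]
  · rintro ⟨a, rfl⟩
    exact Subframe.subset_closure _ ⟨a, rfl⟩

/-- Two pairs suffice: `(⊥, t)` lies in `∇ t` and, read in `Δ s`, gives disjointness; `(s, ⊤)` lies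
in `Δ s` and, read in `∇ t`, gives codisjointness. -/
theorem isCompl_of_openCongr_eq_closedCongr {s t : L} (h : openCongr s = closedCongr t) :
    IsCompl s t := by
  have h1 : s ⊓ ⊥ = s ⊓ t := h.ge ⊥ t (show t ⊔ ⊥ = t ⊔ t by simp)
  have h2 : t ⊔ s = t ⊔ ⊤ := h.le s ⊤ (show s ⊓ s = s ⊓ ⊤ by simp)
  refine IsCompl.of_eq ?_ ?_
  · rw [← h1, inf_bot_eq]
  · rw [sup_comm, h2, sup_top_eq]

/-- `Δ` is an order-reversing embedding, so a join of open congruences that is itself open must come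
from the meet of the parameters. -/
theorem sInf_eq_of_iSup_openCongr {P : Set L} {a : L}
    (h : (⨆ s ∈ P, openCongr s) = openCongr a) : sInf P = a := by
  apply le_antisymm
  · refine openCongr_le_openCongr.1 (h ▸ ?_)
    exact iSup₂_le fun s hs => openCongr_le_openCongr.2 (sInf_le hs)
  · refine le_sInf fun s hs => openCongr_le_openCongr.1 ?_
    exact h ▸ le_iSup₂_of_le s hs le_rfl

/-- A join of open congruences of complemented elements is the closed congruence of the join of
the complements. -/
theorem iSup_openCongr_eq_closedCongr {P : Set L} (hP : ∀ s ∈ P, IsComplemented s) :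
    (⨆ s ∈ P, openCongr s) = closedCongr (sSup {t | ∃ s ∈ P, IsCompl s t}) := by
  rw [closedCongr_sSup]
  apply le_antisymm
  · refine iSup₂_le fun s hs => ?_
    obtain ⟨t, hst⟩ := hP s hs
    rw [openCongr_eq_closedCongr hst]
    exact le_sSup ⟨t, ⟨s, hs, hst⟩, rfl⟩
  · refine sSup_le ?_
    rintro _ ⟨t, ⟨s, hs, hst⟩, rfl⟩
    rw [← openCongr_eq_closedCongr hst]
    exact le_iSup₂_of_le s hs le_rfl

end ClosedCongruences

/-! ### Frith frames whose base consists of complemented elements. -/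

section FrithFrames

/-- `ΔS = ∇L` makes each `Δ s` a closed congruence, whose parameter is a complement of `s`. -/
theorem FrithFrame.IsMono.isComplemented {X : FrithFrame.{u}} (hX : X.IsMono) :
    ∀ s ∈ X.base, IsComplemented s := by
  intro s hs
  have h : openCongr s ∈ (nablaFrame X.frame).carrier := by
    rw [hX.1, ← hX.2]
    exact Subframe.subset_closure _ ⟨s, hs, rfl⟩
  obtain ⟨t, ht⟩ := mem_nablaFrame.1 h
  exact ⟨t, isCompl_of_openCongr_eq_closedCongr ht.symm⟩

theorem FrithFrame.IsSymmetric.isComplemented {X : FrithFrame.{u}} (hX : X.IsSymmetric) :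
    ∀ s ∈ X.base, IsComplemented s := fun s hs => by
  obtain ⟨t, -, hst⟩ := hX s hs
  exact ⟨t, hst⟩

/-- A Frith frame whose base consists of complemented elements is strongly exact and symmetric if
and only if its base contains every complemented element. -/
theorem FrithFrame.isStronglyExactSymmetric_iff {X : FrithFrame.{u}}
    (hX : ∀ s ∈ X.base, IsComplemented s) :
    X.IsStronglyExactSymmetric ↔ ∀ b : X.frame, IsComplemented b → b ∈ X.base := by
  constructor
  · rintro ⟨hse, hsym⟩ b ⟨c, hbc⟩
    -- The complement `c` of `b` is a join of a set `P` of base elements. Their complements `Q` lie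
    -- in the base by symmetry, and the join of `Δ` over `Q` is `∇ c = Δ b`; strong exactness then
    -- puts `b`, the meet of `Q`, in the base.
    obtain ⟨P, hP, rfl⟩ := X.join_dense c
    set Q : Set X.frame := {t | ∃ s ∈ P, IsCompl s t} with hQ
    have hQX : Q ⊆ X.base := by
      rintro t ⟨s, hs, hst⟩
      obtain ⟨t', ht', hst'⟩ := hsym s (hP hs)
      rwa [hst.right_unique hst']
    -- Complements are unique, so complementing `P` twice returns `P`.
    have hQP : {t | ∃ s ∈ Q, IsCompl s t} = P := by
      ext t
      constructor
      · rintro ⟨s, ⟨r, hr, hrs⟩, hst⟩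
        rwa [hst.right_unique hrs.symm]
      · intro ht
        obtain ⟨s, hts⟩ := hX t (hP ht)
        exact ⟨s, ⟨t, ht, hts⟩, hts.symm⟩
    have h : (⨆ s ∈ Q, openCongr s) = openCongr b := by
      rw [iSup_openCongr_eq_closedCongr fun s hs => hX s (hQX hs), hQP,
        openCongr_eq_closedCongr hbc]
    exact sInf_eq_of_iSup_openCongr h ▸ hse Q hQX ⟨b, h⟩
  · intro h
    refine ⟨?_, fun s hs => ?_⟩
    -- The join of `Δ` over `P` is closed in any case; if it is also `Δ a`, then `a` is complemented
    -- and so belongs to the base.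
    · rintro P hP ⟨a, ha⟩
      rw [sInf_eq_of_iSup_openCongr ha]
      rw [iSup_openCongr_eq_closedCongr fun s hs => hX s (hP hs)] at ha
      exact h a ⟨_, isCompl_of_openCongr_eq_closedCongr ha.symm⟩
    · obtain ⟨t, hst⟩ := hX s hs
      exact ⟨t, h t ⟨s, hst.symm⟩, hst⟩

theorem FrithFrame.mem_complSubframe {X : FrithFrame.{u}} (hX : ∀ s ∈ X.base, IsComplemented s)
    (a : X.frame) : a ∈ (complSubframe X.frame).carrier := by
  obtain ⟨P, hP, rfl⟩ := X.join_dense a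
  exact Subframe.sSup_mem _ fun s hs => Subframe.subset_closure _ (hX s (hP hs))

theorem isZeroDimensionalFrame_iff {L : Frm.{u}} :
    IsZeroDimensionalFrame L ↔ ∀ a : L, a ∈ (complSubframe L).carrier := by
  refine ⟨fun h a => ?_, fun h a => exists_sSup_of_mem_complSubframe (h a)⟩
  obtain ⟨P, hP, rfl⟩ := h a
  exact Subframe.sSup_mem _ fun s hs => Subframe.subset_closure _ (hP hs)

theorem FrithFrame.isZeroDimensionalFrame {X : FrithFrame.{u}}
    (hX : ∀ s ∈ X.base, IsComplemented s) : IsZeroDimensionalFrame X.frame :=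
  isZeroDimensionalFrame_iff.2 (X.mem_complSubframe hX)

/-- The inclusion of a subframe as a frame homomorphism. -/
def Subframe.inclusion {L : Type u} [Order.Frame L] (K : Subframe L) : FrameHom K.Elem L where
  toFun := Subframe.Elem.val
  map_inf' _ _ := rfl
  map_top' := rfl
  map_sSup' _ := rfl

/-- The identity of a frame, corestricted to a subframe that contains every element. -/
def Subframe.corestrict {L : Type u} [Order.Frame L] (K : Subframe L)
    (hK : ∀ a, a ∈ K.carrier) : FrameHom L K.Elem where
  toFun a := ⟨a, hK a⟩
  map_inf' _ _ := rfl
  map_top' := rfl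
  map_sSup' A := Subframe.Elem.ext <| by
    change sSup A = sSup (Subframe.Elem.val '' _)
    rw [Set.image_image, Set.image_id']

/-- The inclusion is a frame homomorphism, so an element complemented within `⟨B(L)⟩` is
complemented in `L` and lies in the base. -/
theorem complFrith_isStronglyExactSymmetric (L : Frm.{u}) :
    (complFrith L).IsStronglyExactSymmetric :=
  (FrithFrame.isStronglyExactSymmetric_iff (complFrith_isSymmetric L).isComplemented).2
    fun _ hb => map_isComplemented (complSubframe L).inclusion hb

end FrithFrames

/-! ### The adjunction, and when its unit and counit are invertible. -/

section Adjunction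

/-- The inclusion of the subframe generated by the complemented elements. -/
def complInclusion : complFunctor.{u} ⋙ frithForget ⟶ 𝟭 Frm.{u} where
  app L := Frm.ofHom (complSubframe L).inclusion
  naturality _ _ _ := rfl

theorem isIso_complInclusion_app_iff (L : Frm.{u}) :
    IsIso (complInclusion.app L) ↔ IsZeroDimensionalFrame L := by
  rw [isZeroDimensionalFrame_iff]
  constructor
  · intro _ a
    -- An inverse exhibits each `a` as the image under the inclusion of an element of `⟨B(L)⟩`.
    have h : complInclusion.app L (inv (complInclusion.app L) a) = a := by
      rw [← Frm.comp_apply, IsIso.inv_hom_id]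
      rfl
    rw [← h]
    exact Subframe.Elem.mem _
  · intro h
    exact ⟨Frm.ofHom ((complSubframe L).corestrict h), rfl, rfl⟩

/-- The comparison morphism `(L, S) ⟶ (⟨B(L)⟩, B(L))`, when the elements of `S` are
complemented. -/
def FrithFrame.toComplFrith (X : FrithFrame.{u}) (hX : ∀ s ∈ X.base, IsComplemented s) :
    X ⟶ complFrith X.frame where
  hom := Frm.ofHom ((complSubframe X.frame).corestrict (X.mem_complSubframe hX))
  map_mem := hX

theorem FrithFrame.isIso_toComplFrith_iff (X : FrithFrame.{u})
    (hX : ∀ s ∈ X.base, IsComplemented s) :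
    IsIso (X.toComplFrith hX) ↔ X.IsStronglyExactSymmetric := by
  rw [isStronglyExactSymmetric_iff hX]
  constructor
  · intro _ b hb
    set x : (complSubframe X.frame).Elem := ⟨b, X.mem_complSubframe hX b⟩
    set g : complFrith X.frame ⟶ X := inv (X.toComplFrith hX)
    -- The inverse `g` also fixes underlying elements; being a Frith morphism, it sends the
    -- complemented element `b` into the base of `X`.
    have h : (X.toComplFrith hX).hom (g.hom x) = x :=
      congr_arg (fun f : complFrith X.frame ⟶ complFrith X.frame => f.hom x)
        (IsIso.inv_hom_id (X.toComplFrith hX))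
    have h' : g.hom x = b := congr_arg Subframe.Elem.val h
    exact h' ▸ g.map_mem x hb
  · intro h
    exact ⟨⟨Frm.ofHom (complSubframe X.frame).inclusion, fun s hs => h _ hs⟩, rfl, rfl⟩

/-- The adjunction between the forgetful functor and `L ↦ (⟨B(L)⟩, B(L))`. -/
def monoForgetAdjunction : monoForget.{u} ⊣ complToMono.{u} :=
  -- Unit and counit both leave underlying elements unchanged, so naturality and the triangle
  -- identities hold definitionally.
  Adjunction.mkOfUnitCounit
    { unit :=
        { app := fun X => ObjectProperty.homMk (X.obj.toComplFrith X.property.isComplemented)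
          naturality := fun _ _ _ => rfl }
      counit := complInclusion
      left_triangle := rfl
      right_triangle := rfl }

end Adjunction

/-! ### The equivalence of categories. -/

section Equivalence

/-- The functor `L ↦ (⟨B(L)⟩, B(L))` on zero-dimensional frames. -/
def zeroDimToFrith : ZeroDimFrm.{u} ⥤ SESymFrith.{u} :=
  FrithFrame.IsStronglyExactSymmetric.lift (IsZeroDimensionalFrame.ι ⋙ complFunctor)
    fun L => complFrith_isStronglyExactSymmetric L.obj

/-- The functor `(L, S) ↦ L` on strongly exact symmetric Frith frames. -/
def frithToZeroDim : SESymFrith.{u} ⥤ ZeroDimFrm.{u} :=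
  IsZeroDimensionalFrame.lift (FrithFrame.IsStronglyExactSymmetric.ι ⋙ frithForget)
    fun X => X.obj.isZeroDimensionalFrame X.property.2.isComplemented

/-- The inclusion `⟨B(L)⟩ ⟶ L` is an isomorphism for zero-dimensional `L`. -/
noncomputable def zeroDimCounitIso : zeroDimToFrith.{u} ⋙ frithToZeroDim ≅ 𝟭 ZeroDimFrm.{u} :=
  NatIso.ofComponents
    (fun L => IsZeroDimensionalFrame.isoMk
      (@asIso _ _ _ _ (complInclusion.app L.obj)
        ((isIso_complInclusion_app_iff L.obj).2 L.property)))
    fun _ => rfl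

/-- The comparison `(L, S) ⟶ (⟨B(L)⟩, B(L))` is an isomorphism for strongly exact symmetric
`(L, S)`. -/
noncomputable def frithUnitIso : 𝟭 SESymFrith.{u} ≅ frithToZeroDim ⋙ zeroDimToFrith :=
  NatIso.ofComponents
    (fun X => FrithFrame.IsStronglyExactSymmetric.isoMk
      (@asIso _ _ _ _ (X.obj.toComplFrith X.property.2.isComplemented)
        ((X.obj.isIso_toComplFrith_iff _).2 X.property)))
    fun _ => rfl

/-- The equivalence between zero-dimensional frames and strongly exact symmetric Frith frames. -/
noncomputable def zeroDimEquivalence : ZeroDimFrm.{u} ≌ SESymFrith.{u} :=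
  -- Here `B` is the functor and `U` the inverse, opposite to their roles in the adjunction. The
  -- unit of the equivalence is thus the inverse of the adjunction's counit, and its counit the
  -- inverse of the adjunction's unit.
  .mk zeroDimToFrith frithToZeroDim zeroDimCounitIso.symm frithUnitIso.symm

end Equivalence

/-- `a ↦ ∇ a`, as an isomorphism onto a subframe of congruences equal to `∇L`. -/
noncomputable def closedCongrOrderIso {L : Type u} [Order.Frame L]
    (K : Subframe (FrameCongruence L)) (hK : nablaFrame L = K) : L ≃o K.Elem :=
  RelIso.ofSurjective
    (OrderEmbedding.ofMapLEIff
      (fun a => (⟨closedCongr a, hK ▸ mem_nablaFrame.2 ⟨a, rfl⟩⟩ : K.Elem))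
      fun _ _ => closedCongr_le_closedCongr)
    fun θ => by
      obtain ⟨a, ha⟩ := mem_nablaFrame.1 (hK.symm ▸ θ.mem : θ.val ∈ (nablaFrame L).carrier)
      exact ⟨a, Subframe.Elem.ext ha⟩

theorem mainTheorem6 :
    (∃ e : ZeroDimFrm.{u} ≌ SESymFrith.{u},
      Nonempty (e.functor ⋙ FrithFrame.IsStronglyExactSymmetric.ι ≅
        IsZeroDimensionalFrame.ι ⋙ complFunctor) ∧
      Nonempty (e.inverse ⋙ IsZeroDimensionalFrame.ι ≅
        FrithFrame.IsStronglyExactSymmetric.ι ⋙ frithForget)) ∧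
    (∃ adj : monoForget.{u} ⊣ complToMono.{u},
      (∀ L : Frm.{u}, IsIso (adj.counit.app L) ↔ IsZeroDimensionalFrame L) ∧
      (∀ X : MonoFrith.{u}, IsIso (adj.unit.app X) ↔
        FrithFrame.IsStronglyExactSymmetric X.obj)) ∧
    (∀ X : MonoFrith.{u}, ∃ ν : X.obj.frame ≃o (congrFrame X.obj.base).Elem,
      ∀ a : X.obj.frame, (ν a).val = closedCongr a) := by
  refine ⟨⟨zeroDimEquivalence, ⟨Iso.refl _⟩, ⟨Iso.refl _⟩⟩,
    ⟨monoForgetAdjunction, fun L => isIso_complInclusion_app_iff L, fun X => ?_⟩,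
    fun X => ⟨closedCongrOrderIso _ X.property.1, fun _ => rfl⟩⟩
  -- Invertibility in the full subcategory is invertibility of the underlying morphism of Frith
  -- frames.
  rw [← ObjectProperty.isIso_hom_iff]
  exact X.obj.isIso_toComplFrith_iff X.property.isComplemented
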